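/- Let $p\in\mathbb{N}$ and let $w=(w_1,\dots,w_p)\in\mathbb{R}^p$ satisfy $w_1>\dots>w_p>0$. For $b\in\mathbb{R}^p$ let $|b|_{(1)}\ge\dots\ge|b|_{(p)}$ be the absolute values of the components of $b$ in decreasing order, let $\|b\|_w=\sum_{j=1}^p w_j|b|_{(j)}$ be the SLOPE norm, and let $$F_w(x)=\partial\|\cdot\|_w(x)=\{s\in\mathbb{R}^p:\ \|z\|_w\ge\|x\|_w+s'(z-x)\ \text{ for all } z\in\mathbb{R}^p\}$$ be its subdifferential at $x\in\mathbb{R}^p$. The sign permutahedron is $$P_w^\pm=\mathrm{conv}\{(\sigma_1w_{\pi(1)},\dots,\sigma_pw_{\pi(p)})' :\ \sigma\in\{-1,1\}^p,\ \pi \text{ a permutation of } \{1,\dots,p\}\}.$$ A face of $P_w^\pm$ is a set of the form $\{x\in P_w^\pm : a'x=b_0\}$, where $a\in\mathbb{R}^p$ and $b_0\in\mathbb{R}$ are such that $a'x\le b_0$ for all $x\in P_w^\pm$; the codimension of a non-empty face $F$ is $p$ minus the dimension of its affine hull. A SLOPE model is a vector $m\in\mathbb{Z}^p$ such that $m=0$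 or, for every integer $1\le l\le\|m\|_\infty$, there is an index $j$ with $|m_j|=l$. For $x\in\mathbb{R}^p$ let $\mathrm{mdl}(x)$ be the unique SLOPE model such that, for all $i,j$: $\mathrm{sign}(\mathrm{mdl}(x)_i)=\mathrm{sign}(x_i)$; $|x_i|=|x_j|$ implies $|\mathrm{mdl}(x)_i|=|\mathrm{mdl}(x)_j|$; and $|x_i|>|x_j|$ implies $|\mathrm{mdl}(x)_i|>|\mathrm{mdl}(x)_j|$. **Theorem.** The map $m\mapsto F_w(m)$ is a bijection from the set of SLOPE models in $\mathbb{Z}^p$ onto the set of non-empty faces of $P_w^\pm$. Moreover: 1. for every SLOPE model $m$, the codimension of $F_w(m)$ equals $\|m\|_\infty$; 2. for every $x\in\mathbb{R}^p$, $F_w(x)=F_w(\mathrm{mdl}(x))$. -/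

import Mathlib

open scoped Matrix

noncomputable section

/-- The subdifferential of `f : ℝᵖ → ℝ` at `x`: all `s` with `f z ≥ f x + s'(z - x)` for all `z`. -/
def subdifferential {p : ℕ} (f : (Fin p → ℝ) → ℝ) (x : Fin p → ℝ) : Set (Fin p → ℝ) :=
  {s | ∀ z : Fin p → ℝ, f z ≥ f x + s ⬝ᵥ (z - x)}

/-- The order statistics `|b|_(1) ≥ … ≥ |b|_(p)` of the absolute values of the components of `b`:
the entries `|b i|`, rearranged in decreasing order. -/
def absOrderStat {p : ℕ} (b : Fin p → ℝ) (j : Fin p) : ℝ :=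
  |b (Tuple.sort (fun i => -|b i|) j)|

theorem absOrderStat_antitone {p : ℕ} (b : Fin p → ℝ) : Antitone (absOrderStat b) := by
  intro i j hij
  have h := Tuple.monotone_sort (fun i => -|b i|) hij
  simp only [Function.comp] at h
  simp only [absOrderStat]
  linarith

/-- The SLOPE norm `‖b‖_w = ∑ⱼ wⱼ |b|_(j)`. -/
def slopeNorm {p : ℕ} (w b : Fin p → ℝ) : ℝ :=
  ∑ j, w j * absOrderStat b j

/-- `F_w(x)`, the subdifferential of the SLOPE norm at `x`. -/
def slopeFace {p : ℕ} (w x : Fin p → ℝ) : Set (Fin p → ℝ) :=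
  subdifferential (slopeNorm w) x

/-- The sign permutahedron `P_w^±`. -/
def signPermutahedron {p : ℕ} (w : Fin p → ℝ) : Set (Fin p → ℝ) :=
  convexHull ℝ {v | ∃ (σ : Fin p → ℝ) (π : Equiv.Perm (Fin p)),
    (∀ i, σ i = 1 ∨ σ i = -1) ∧ v = fun i => σ i * w (π i)}

/-- `F` is a face of `P`: `F = {x ∈ P : a'x = b₀}` for some inequality `a'x ≤ b₀` valid on `P`. -/
def IsFace {p : ℕ} (P F : Set (Fin p → ℝ)) : Prop :=
  ∃ (a : Fin p → ℝ) (b₀ : ℝ), (∀ x ∈ P, a ⬝ᵥ x ≤ b₀) ∧ F = {x ∈ P | a ⬝ᵥ x = b₀}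

/-- The set of non-empty faces of `P`. -/
def nonemptyFaces {p : ℕ} (P : Set (Fin p → ℝ)) : Set (Set (Fin p → ℝ)) :=
  {F | F.Nonempty ∧ IsFace P F}

/-- `codim F = p - dim (aff F)`, as an integer (used for non-empty `F` only). -/
def codim {p : ℕ} (F : Set (Fin p → ℝ)) : ℤ :=
  (p : ℤ) - (Module.finrank ℝ (affineSpan ℝ F).direction : ℤ)

/-- The SLOPE models of dimension `p`; the norm on `Fin p → ℤ` is the supremum norm. -/
def slopeModels (p : ℕ) : Set (Fin p → ℤ) :=
  {m | m = 0 ∨ ∀ l : ℕ, 1 ≤ l → (l : ℝ) ≤ ‖m‖ → ∃ j, |m j| = (l : ℤ)}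

/-- The defining properties of `m = mdl(x)`. -/
structure IsModelOf {p : ℕ} (x : Fin p → ℝ) (m : Fin p → ℤ) : Prop where
  mem_slopeModels : m ∈ slopeModels p
  sign_eq : ∀ i, SignType.sign (m i) = SignType.sign (x i)
  abs_eq : ∀ i j, |x i| = |x j| → |m i| = |m j|
  abs_lt : ∀ i j, |x i| > |x j| → |m i| > |m j|

/-- The distinct positive values among the `|x j|` that are at most `t`. -/
def posLevels {p : ℕ} (x : Fin p → ℝ) (t : ℝ) : Finset ℝ :=
  (Finset.univ.image fun j => |x j|).filter fun s => 0 < s ∧ s ≤ t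

theorem mem_posLevels {p : ℕ} {x : Fin p → ℝ} {t s : ℝ} :
    s ∈ posLevels x t ↔ (∃ j, |x j| = s) ∧ 0 < s ∧ s ≤ t := by
  simp [posLevels]

theorem exists_card_posLevels {p : ℕ} (x : Fin p → ℝ) (l : ℕ) (hl : 1 ≤ l) :
    ∀ (n : ℕ) (i : Fin p), (posLevels x |x i|).card = n → l ≤ n →
      ∃ j, (posLevels x |x j|).card = l := by
  intro n
  induction n with
  | zero => intro i _ h; omega
  | succ n ih =>
    intro i hi h
    rcases Nat.lt_or_ge n l with hn | hn
    · exact ⟨i, by omega⟩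
    have hne : (posLevels x |x i|).Nonempty := by
      rw [← Finset.card_pos]; omega
    have hpos : 0 < |x i| := by
      obtain ⟨s, hs⟩ := hne
      obtain ⟨_, h1, h2⟩ := mem_posLevels.1 hs
      linarith
    have hmem : |x i| ∈ posLevels x |x i| := mem_posLevels.2 ⟨⟨i, rfl⟩, hpos, le_rfl⟩
    have hcard := Finset.card_erase_of_mem hmem
    have hne' : ((posLevels x |x i|).erase |x i|).Nonempty := by
      rw [← Finset.card_pos]; omega
    have hmax := Finset.max'_mem _ hne'
    obtain ⟨hmne, hmm⟩ := Finset.mem_erase.1 hmax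
    obtain ⟨⟨k, hk⟩, hk0, hki⟩ := mem_posLevels.1 hmm
    have hS : posLevels x |x k| = (posLevels x |x i|).erase |x i| := by
      ext s
      rw [Finset.mem_erase, mem_posLevels, mem_posLevels, hk]
      constructor
      · rintro ⟨a, b, c⟩
        exact ⟨(lt_of_le_of_lt c (lt_of_le_of_ne hki hmne)).ne, a, b, c.trans hki⟩
      · rintro ⟨a, b, c, d⟩
        exact ⟨b, c, Finset.le_max' _ _ (Finset.mem_erase.2 ⟨a, mem_posLevels.2 ⟨b, c, d⟩⟩)⟩
    exact ih k (by rw [hS]; omega) hn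

theorem exists_abs_eq_of_le_norm {p : ℕ} {m : Fin p → ℤ} {l : ℕ} (hl : 1 ≤ l)
    (h : (l : ℝ) ≤ ‖m‖) : ∃ i, (l : ℤ) ≤ |m i| := by
  by_contra! hc
  have h0 : (0 : ℝ) < l := by exact_mod_cast hl
  have : ‖m‖ < (l : ℝ) := by
    rw [pi_norm_lt_iff h0]
    intro i
    rw [Int.norm_eq_abs]
    exact_mod_cast hc i
  linarith

theorem abs_le_norm {p : ℕ} (m : Fin p → ℤ) (i : Fin p) : ((|m i| : ℤ) : ℝ) ≤ ‖m‖ := by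
  have := norm_le_pi_norm m i
  rw [Int.norm_eq_abs] at this
  push_cast
  exact this

/-- The properties above determine `|m i|`. -/
theorem IsModelOf.abs_apply {p : ℕ} {x : Fin p → ℝ} {m : Fin p → ℤ} (h : IsModelOf x m)
    (i : Fin p) : |m i| = ((posLevels x |x i|).card : ℤ) := by
  have hzero : ∀ j, m j = 0 ↔ x j = 0 := fun j => by
    rw [← sign_eq_zero_iff, h.sign_eq j, sign_eq_zero_iff]
  have hpos : ∀ j, 0 < |m j| ↔ 0 < |x j| := fun j => by
    rw [abs_pos, abs_pos, Ne, Ne, hzero j]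
  have hle : ∀ j k, |x j| ≤ |x k| → |m j| ≤ |m k| := fun j k hjk => by
    rcases hjk.lt_or_eq with h1 | h1
    · exact (h.abs_lt k j h1).le
    · exact (h.abs_eq j k h1).le
  have hle' : ∀ j k, |m j| ≤ |m k| → |x j| ≤ |x k| := fun j k hjk => by
    by_contra! hc
    have := h.abs_lt j k hc
    omega
  have hsurj : ∀ l : ℕ, 1 ≤ l → (l : ℤ) ≤ |m i| → ∃ j, |m j| = (l : ℤ) := by
    intro l hl hli
    rcases h.mem_slopeModels with h0 | h0
    · simp [h0] at hli; omega
    · refine h0 l hl (le_trans ?_ (abs_le_norm m i))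
      exact_mod_cast hli
  have hna : ∀ j, ((m j).natAbs : ℤ) = |m j| := fun j => Int.natCast_natAbs _
  have hnai := hna i
  have key : (posLevels x |x i|).card = (Finset.Icc 1 (m i).natAbs).card := by
    symm
    have hs : ∀ l ∈ Finset.Icc 1 (m i).natAbs, ∃ j, |m j| = (l : ℤ) := fun l hl => by
      rw [Finset.mem_Icc] at hl
      exact hsurj l hl.1 (by omega)
    refine Finset.card_bij (fun l hl => |x (hs l hl).choose|) ?_ ?_ ?_
    · intro l hl
      have hc := (hs l hl).choose_spec
      rw [Finset.mem_Icc] at hl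
      refine mem_posLevels.2 ⟨⟨_, rfl⟩, (hpos _).1 ?_, hle' _ _ ?_⟩ <;> rw [hc] <;> omega
    · intro l hl l' hl' heq
      have hc := (hs l hl).choose_spec
      have hc' := (hs l' hl').choose_spec
      have := h.abs_eq _ _ heq
      rw [hc, hc'] at this
      exact_mod_cast this
    · intro s hsm
      obtain ⟨⟨j, rfl⟩, h0, h1⟩ := mem_posLevels.1 hsm
      have hj0 := (hpos j).2 h0
      have hj1 := hle _ _ h1
      have hnaj := hna j
      have hm : (m j).natAbs ∈ Finset.Icc 1 (m i).natAbs := by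
        rw [Finset.mem_Icc]; omega
      refine ⟨(m j).natAbs, hm, ?_⟩
      have hc := (hs _ hm).choose_spec
      have hc2 := hc.trans hnaj
      exact le_antisymm (hle' _ _ hc2.le) (hle' _ _ hc2.ge)
  rw [key]
  simp

/-- Every `x` has exactly one SLOPE model. -/
theorem existsUnique_isModelOf {p : ℕ} (x : Fin p → ℝ) : ∃! m : Fin p → ℤ, IsModelOf x m := by
  have hzero : ∀ i, x i = 0 → (posLevels x |x i|).card = 0 := fun i hi => by
    rw [Finset.card_eq_zero, Finset.eq_empty_iff_forall_notMem]
    intro s hs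
    obtain ⟨_, h1, h2⟩ := mem_posLevels.1 hs
    rw [hi, abs_zero] at h2
    linarith
  have hposc : ∀ i, x i ≠ 0 → 0 < (posLevels x |x i|).card := fun i hi =>
    Finset.card_pos.2 ⟨|x i|, mem_posLevels.2 ⟨⟨i, rfl⟩, abs_pos.2 hi, le_rfl⟩⟩
  let m : Fin p → ℤ := fun i => (SignType.sign (x i) : ℤ) * ((posLevels x |x i|).card : ℤ)
  have habs : ∀ i, |m i| = ((posLevels x |x i|).card : ℤ) := fun i => by
    rcases lt_trichotomy (x i) 0 with hi | hi | hi
    · simp [m, sign_neg hi]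
    · simp [m, hzero i hi]
    · simp [m, sign_pos hi]
  have hm : IsModelOf x m := by
    refine ⟨Or.inr fun l hl hle => ?_, fun i => ?_, fun i j hij => ?_, fun i j hij => ?_⟩
    · obtain ⟨i, hi⟩ := exists_abs_eq_of_le_norm hl hle
      rw [habs] at hi
      obtain ⟨j, hj⟩ := exists_card_posLevels x l hl _ i rfl (by exact_mod_cast hi)
      exact ⟨j, by rw [habs, hj]⟩
    · rcases lt_trichotomy (x i) 0 with hi | hi | hi
      · have := hposc i hi.ne
        have h2 : m i < 0 := by simp only [m, sign_neg hi]; simpa using this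
        rw [sign_neg h2, sign_neg hi]
      · have h2 : m i = 0 := by simp [m, hi]
        rw [h2, hi, sign_zero, sign_zero]
      · have := hposc i hi.ne'
        have h2 : 0 < m i := by simp only [m, sign_pos hi]; simpa using this
        rw [sign_pos h2, sign_pos hi]
    · rw [habs, habs, hij]
    · rw [habs, habs]
      have : (posLevels x |x j|).card < (posLevels x |x i|).card := by
        refine Finset.card_lt_card (Finset.ssubset_iff_of_subset ?_ |>.2 ⟨|x i|, ?_, ?_⟩)
        · intro s hs
          obtain ⟨h1, h2, h3⟩ := mem_posLevels.1 hs
          exact mem_posLevels.2 ⟨h1, h2, h3.trans hij.le⟩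
        · exact mem_posLevels.2 ⟨⟨i, rfl⟩, lt_of_le_of_lt (abs_nonneg _) hij, le_rfl⟩
        · intro hs
          have := (mem_posLevels.1 hs).2.2
          linarith
      exact_mod_cast this
  refine ⟨m, hm, fun m' hm' => funext fun i => ?_⟩
  have h1 : |m' i| = |m i| := by rw [hm'.abs_apply i, hm.abs_apply i]
  have h2 : SignType.sign (m' i) = SignType.sign (m i) := by rw [hm'.sign_eq, hm.sign_eq]
  rw [← sign_mul_abs (m' i), ← sign_mul_abs (m i), h1, h2]

/-- `mdl(x)`, the SLOPE model of `x`. -/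
def mdl {p : ℕ} (x : Fin p → ℝ) : Fin p → ℤ :=
  (existsUnique_isModelOf x).choose

theorem isModelOf_mdl {p : ℕ} (x : Fin p → ℝ) : IsModelOf x (mdl x) :=
  (existsUnique_isModelOf x).choose_spec.1

end

/-!
The SLOPE norm is the support function of the sign permutahedron `P`: by the rearrangement
inequality, a generator `v = (σᵢ w_{π i})` satisfies `v'x ≤ ‖x‖_w`, with equality exactly when the
signs of `v` agree with those of `x` and `|v|` is ordered like `|x|` (`IsAligned`,
`signedPerm_dotProduct_eq_iff`). Separating a point from the closed convex set `P` then identifies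
`F_w(x)` with the face `{s ∈ P : s'x = ‖x‖_w}` exposed by `x` (`mem_slopeFace_iff`), and every
non-empty face is of this form.

Since a face is determined by the generators it contains, and alignment depends only on the signs of
`x` and on the order of the `|x i|`, vectors with the same signs and order expose the same face.
The converse also holds (`slopeFace_eq_iff`): the generators in a face reveal this data, because
`w` is strictly decreasing and positive, so that flipping a sign or exchanging two entries really
moves a generator. A SLOPE model is the canonical representative of its class of signs and order,
whence the bijection and the equality `F_w(x) = F_w(mdl(x))`.

For the codimension, the functionals that are constant on `F_w(m)` form the annihilator of the
direction of its affine hull. They are exactly the vectors `a` with `a i = sign (m i) * c (|m i|)`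
(`const_iff_mem_range_layerMap`): the same flips and exchanges show that nothing else is constant,
and conversely `K m + a` has the signs and order of `m` when `K` is large, so exposes the same face.
As every level `1, …, ‖m‖_∞` of a SLOPE model occurs, this space has dimension `‖m‖_∞`.
-/

/-! ### The SLOPE norm as the support function of the sign permutahedron -/

/-- `σ` is a vector of signs. -/
def IsSignVector {p : ℕ} (σ : Fin p → ℝ) : Prop :=
  ∀ i, σ i = 1 ∨ σ i = -1

/-- The vector obtained from `w` by permuting its entries by `π` and multiplying by the signs `σ`;
these vectors generate the sign permutahedron. -/
def signedPerm {p : ℕ} (w σ : Fin p → ℝ) (π : Equiv.Perm (Fin p)) : Fin p → ℝ :=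
  fun i => σ i * w (π i)

theorem signedPerm_mem {p : ℕ} (w : Fin p → ℝ) {σ : Fin p → ℝ} (hσ : IsSignVector σ)
    (π : Equiv.Perm (Fin p)) : signedPerm w σ π ∈ signPermutahedron w :=
  subset_convexHull ℝ _ ⟨σ, π, hσ, rfl⟩

/-- To show that `P_w^±` lies in a convex set, look at its generators. -/
theorem signPermutahedron_subset {p : ℕ} {w : Fin p → ℝ} {t : Set (Fin p → ℝ)} (ht : Convex ℝ t)
    (h : ∀ σ π, IsSignVector σ → signedPerm w σ π ∈ t) : signPermutahedron w ⊆ t := by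
  refine convexHull_min ?_ ht
  rintro _ ⟨σ, π, hσ, rfl⟩
  exact h σ π hσ

theorem isClosed_signPermutahedron {p : ℕ} (w : Fin p → ℝ) : IsClosed (signPermutahedron w) := by
  refine Set.Finite.isClosed_convexHull ℝ ?_
  have hfin : (Set.univ.pi fun _ : Fin p => ({1, -1} : Set ℝ)).Finite :=
    Set.Finite.pi fun _ => by simp
  refine ((hfin.prod (Set.finite_univ (α := Equiv.Perm (Fin p)))).image
    fun q => signedPerm w q.1 q.2).subset ?_
  rintro _ ⟨σ, π, hσ, rfl⟩
  exact ⟨(σ, π), ⟨fun i _ => by simpa using hσ i, trivial⟩, rfl⟩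

/-- The rearrangement inequality, with its equality case. -/
theorem sum_perm_mul_abs_le {p : ℕ} {w : Fin p → ℝ} (hw : Antitone w) (x : Fin p → ℝ)
    (π : Equiv.Perm (Fin p)) :
    ∑ i, w (π i) * |x i| ≤ slopeNorm w x ∧
      (∑ i, w (π i) * |x i| = slopeNorm w x ↔ Monovary (w ∘ π) (fun i => |x i|)) := by
  set τ := Tuple.sort (fun i => -|x i|) with hτ
  have hmono : Monovary w (absOrderStat x) := hw.monovary (absOrderStat_antitone x)
  have hsum : ∑ i, w (π i) * |x i| = ∑ j, w ((π * τ) j) * absOrderStat x j :=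
    (Equiv.sum_comp τ fun i => w (π i) * |x i|).symm
  rw [hsum]
  refine ⟨hmono.sum_comp_perm_mul_le_sum_mul, ?_⟩
  refine hmono.sum_comp_perm_mul_eq_sum_mul_iff.trans ⟨fun h => ?_, fun h => ?_⟩
  · intro i j hij
    have := @h (τ.symm i) (τ.symm j)
    simp only [absOrderStat, ← hτ, Function.comp, Equiv.Perm.mul_apply,
      Equiv.apply_symm_apply] at this
    exact this hij
  · exact h.comp_right τ

/-- The signs `σ` agree with those of `x`, and the entries `w (π i)` are ordered like the `|x i|`. The
generators `v` of the sign permutahedron with `v'x = ‖x‖_w` are those given by such pairs `(σ, π)`. -/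
structure IsAligned {p : ℕ} (w x σ : Fin p → ℝ) (π : Equiv.Perm (Fin p)) : Prop where
  sign_mul : ∀ i, σ i * x i = |x i|
  monovary : Monovary (w ∘ π) (fun i => |x i|)

theorem IsSignVector.mul_le_abs {p : ℕ} {σ : Fin p → ℝ} (hσ : IsSignVector σ) (x : Fin p → ℝ)
    (i : Fin p) : σ i * x i ≤ |x i| := by
  rcases hσ i with h | h <;> rw [h]
  · simpa using le_abs_self (x i)
  · simpa using neg_le_abs (x i)

theorem dotProduct_signedPerm {p : ℕ} (w x σ : Fin p → ℝ) (π : Equiv.Perm (Fin p)) :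
    signedPerm w σ π ⬝ᵥ x = ∑ i, w (π i) * (σ i * x i) := by
  simp only [dotProduct, signedPerm]
  exact Finset.sum_congr rfl fun i _ => by ring

theorem exists_isAligned {p : ℕ} {w : Fin p → ℝ} (hw : Antitone w) (x : Fin p → ℝ) :
    ∃ (σ : Fin p → ℝ) (π : Equiv.Perm (Fin p)), IsSignVector σ ∧ IsAligned w x σ π := by
  refine ⟨fun i => if 0 ≤ x i then 1 else -1, (Tuple.sort (fun i => -|x i|)).symm,
    fun i => ?_, fun i => ?_, fun i j hij => ?_⟩
  · by_cases h : 0 ≤ x i <;> simp [h]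
  · by_cases h : 0 ≤ x i
    · simp [h, abs_of_nonneg h]
    · simp [h, abs_of_neg (not_le.1 h)]
  · refine hw ?_
    by_contra! hc
    have := absOrderStat_antitone x hc.le
    simp only [absOrderStat, Equiv.apply_symm_apply] at this
    linarith

section

variable {p : ℕ} {w : Fin p → ℝ} (hw : StrictAnti w) (hpos : ∀ j, 0 < w j)
include hw hpos

theorem signedPerm_dotProduct_le {σ : Fin p → ℝ} (hσ : IsSignVector σ) (π : Equiv.Perm (Fin p))
    (x : Fin p → ℝ) : signedPerm w σ π ⬝ᵥ x ≤ slopeNorm w x := by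
  rw [dotProduct_signedPerm]
  exact (Finset.sum_le_sum fun i _ => mul_le_mul_of_nonneg_left (hσ.mul_le_abs x i)
    (hpos _).le).trans (sum_perm_mul_abs_le hw.antitone x π).1

theorem signedPerm_dotProduct_eq_iff {σ : Fin p → ℝ} (hσ : IsSignVector σ)
    (π : Equiv.Perm (Fin p)) (x : Fin p → ℝ) :
    signedPerm w σ π ⬝ᵥ x = slopeNorm w x ↔ IsAligned w x σ π := by
  rw [dotProduct_signedPerm]
  have hterm : ∀ i ∈ Finset.univ, w (π i) * (σ i * x i) ≤ w (π i) * |x i| := fun i _ =>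
    mul_le_mul_of_nonneg_left (hσ.mul_le_abs x i) (hpos _).le
  have h1 := Finset.sum_le_sum hterm
  obtain ⟨h2, h3⟩ := sum_perm_mul_abs_le hw.antitone x π
  constructor
  · intro h
    have h4 := (Finset.sum_eq_sum_iff_of_le hterm).1 (le_antisymm h1 (by linarith))
    exact ⟨fun i => mul_left_cancel₀ (hpos _).ne' (h4 i (Finset.mem_univ i)),
      h3.1 (by linarith)⟩
  · intro h
    rw [← h3.2 h.monovary]
    exact Finset.sum_congr rfl fun i _ => by rw [h.sign_mul]

theorem dotProduct_le_slopeNorm {s : Fin p → ℝ} (hs : s ∈ signPermutahedron w) (x : Fin p → ℝ) :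
    s ⬝ᵥ x ≤ slopeNorm w x := by
  refine signPermutahedron_subset (t := {s | s ⬝ᵥ x ≤ slopeNorm w x}) ?_
    (fun σ π hσ => signedPerm_dotProduct_le hw hpos hσ π x) hs
  exact convex_halfSpace_le ⟨fun a b => add_dotProduct a b x, fun c a => smul_dotProduct c a x⟩ _

/-- The subdifferential of the SLOPE norm at `x` is the face of the sign permutahedron exposed
by `x`. -/
theorem mem_slopeFace_iff {x s : Fin p → ℝ} :
    s ∈ slopeFace w x ↔ s ∈ signPermutahedron w ∧ s ⬝ᵥ x = slopeNorm w x := by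
  constructor
  · intro h
    have h' : ∀ z, slopeNorm w z ≥ slopeNorm w x + (s ⬝ᵥ z - s ⬝ᵥ x) := fun z => by
      rw [← dotProduct_sub]; exact h z
    have hmax : ∀ c : ℝ, 0 ≤ c → slopeNorm w (c • x) ≤ c * slopeNorm w x := fun c hc => by
      obtain ⟨σ, π, hσ, ha⟩ := exists_isAligned hw.antitone (c • x)
      rw [← (signedPerm_dotProduct_eq_iff hw hpos hσ π _).2 ha, dotProduct_smul, smul_eq_mul]
      exact mul_le_mul_of_nonneg_left (signedPerm_dotProduct_le hw hpos hσ π x) hc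
    -- testing the subgradient inequality at `0` and `2x` gives `s'x = ‖x‖_w`
    have h0 := h' ((0 : ℝ) • x)
    have h2 := h' ((2 : ℝ) • x)
    have e0 := hmax 0 le_rfl
    have e2 := hmax 2 (by norm_num)
    simp only [dotProduct_smul, smul_eq_mul] at h0 h2
    have heq : s ⬝ᵥ x = slopeNorm w x := by linarith
    refine ⟨?_, heq⟩
    by_contra hs
    obtain ⟨f, u, hf, hu⟩ := geometric_hahn_banach_closed_point (convex_convexHull ℝ _)
      (isClosed_signPermutahedron w) hs
    set z := (dotProductEquiv ℝ (Fin p)).symm f.toLinearMap with hz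
    have hfz : ∀ y, f y = y ⬝ᵥ z := fun y => by
      have := LinearMap.congr_fun ((dotProductEquiv ℝ (Fin p)).apply_symm_apply f.toLinearMap) y
      rw [← hz] at this
      rw [dotProduct_comm]
      exact this.symm
    obtain ⟨σ, π, hσ, ha⟩ := exists_isAligned hw.antitone z
    have h3 := (signedPerm_dotProduct_eq_iff hw hpos hσ π _).2 ha
    have h4 := hf _ (signedPerm_mem w hσ π)
    have h5 := h' z
    rw [hfz] at h4 hu
    linarith
  · rintro ⟨hs, hx⟩ z
    rw [dotProduct_sub, hx]
    have := dotProduct_le_slopeNorm hw hpos hs z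
    linarith

theorem signedPerm_mem_slopeFace_iff {σ : Fin p → ℝ} (hσ : IsSignVector σ)
    {π : Equiv.Perm (Fin p)} {x : Fin p → ℝ} :
    signedPerm w σ π ∈ slopeFace w x ↔ IsAligned w x σ π := by
  rw [mem_slopeFace_iff hw hpos, signedPerm_dotProduct_eq_iff hw hpos hσ]
  exact and_iff_right (signedPerm_mem w hσ π)

/-- A face of the sign permutahedron is determined by the generators that it contains. -/
theorem slopeFace_subset_of_isAligned {x y : Fin p → ℝ}
    (h : ∀ σ π, IsSignVector σ → IsAligned w x σ π → IsAligned w y σ π) :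
    slopeFace w x ⊆ slopeFace w y := by
  have key : signPermutahedron w ⊆ {s | s ⬝ᵥ x ≤ slopeNorm w x ∧ s ⬝ᵥ y ≤ slopeNorm w y ∧
      (s ⬝ᵥ x = slopeNorm w x → s ⬝ᵥ y = slopeNorm w y)} := by
    refine signPermutahedron_subset ?_ fun σ π hσ => ⟨signedPerm_dotProduct_le hw hpos hσ π x,
      signedPerm_dotProduct_le hw hpos hσ π y, ?_⟩
    · -- equality in a proper convex combination of inequalities forces equality in both
      rw [convex_iff_forall_pos]
      rintro s ⟨s1, s2, s3⟩ t ⟨t1, t2, t3⟩ a b ha hb hab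
      simp only [Set.mem_ofPred_eq, add_dotProduct, smul_dotProduct, smul_eq_mul]
      obtain rfl : b = 1 - a := by linarith
      refine ⟨by nlinarith, by nlinarith, fun he => ?_⟩
      have hs : s ⬝ᵥ x = slopeNorm w x := by nlinarith
      have ht : t ⬝ᵥ x = slopeNorm w x := by nlinarith
      rw [s3 hs, t3 ht]
      ring
    · rw [signedPerm_dotProduct_eq_iff hw hpos hσ, signedPerm_dotProduct_eq_iff hw hpos hσ]
      exact h σ π hσ
  intro s hs
  rw [mem_slopeFace_iff hw hpos] at hs ⊢
  exact ⟨hs.1, (key hs.1).2.2 hs.2⟩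

end

/-! ### Equality of faces -/

/-- `x` and `y` have the same signs, and their absolute values are ordered in the same way. -/
structure SameSignedOrder {p : ℕ} (x y : Fin p → ℝ) : Prop where
  sign_eq : ∀ i, SignType.sign (x i) = SignType.sign (y i)
  abs_lt_iff : ∀ i j, |x i| < |x j| ↔ |y i| < |y j|

theorem SameSignedOrder.symm {p : ℕ} {x y : Fin p → ℝ} (h : SameSignedOrder x y) :
    SameSignedOrder y x :=
  ⟨fun i => (h.sign_eq i).symm, fun i j => (h.abs_lt_iff i j).symm⟩

theorem sign_intCast_real (n : ℤ) : SignType.sign (n : ℝ) = SignType.sign n := by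
  rcases lt_trichotomy n 0 with h | rfl | h
  · rw [sign_neg h, sign_neg (by exact_mod_cast h)]
  · simp
  · rw [sign_pos h, sign_pos (by exact_mod_cast h)]

/-- A SLOPE model of `x` is a SLOPE model that, as a real vector, has the signs and the order of
`x`. -/
theorem isModelOf_iff {p : ℕ} {x : Fin p → ℝ} {m : Fin p → ℤ} :
    IsModelOf x m ↔ m ∈ slopeModels p ∧ SameSignedOrder x (fun i => (m i : ℝ)) := by
  have hcast : ∀ i j, |(m i : ℝ)| < |(m j : ℝ)| ↔ |m i| < |m j| := fun i j => by
    exact_mod_cast Iff.rfl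
  constructor
  · intro h
    refine ⟨h.mem_slopeModels, fun i => ?_, fun i j => ?_⟩
    · rw [sign_intCast_real, h.sign_eq]
    · rw [hcast]
      refine ⟨fun hij => h.abs_lt j i hij, fun hij => ?_⟩
      by_contra! hc
      rcases hc.lt_or_eq with h1 | h1
      · exact (h.abs_lt i j h1).asymm hij
      · exact hij.ne (h.abs_eq i j h1.symm)
  · rintro ⟨h0, h1, h2⟩
    refine ⟨h0, fun i => ?_, fun i j hij => ?_, fun i j hij => ?_⟩
    · rw [h1, sign_intCast_real]
    · have a := (h2 i j).not.1 hij.not_lt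
      have b := (h2 j i).not.1 hij.not_gt
      rw [hcast] at a b
      omega
    · exact (hcast j i).1 ((h2 j i).1 hij)

theorem sign_mul_eq_abs_iff {s x : ℝ} (hs : s = 1 ∨ s = -1) :
    s * x = |x| ↔ x = 0 ∨ (SignType.sign x : ℝ) = s := by
  rcases lt_trichotomy x 0 with h | rfl | h
  · rw [abs_of_neg h, sign_neg h]
    rcases hs with rfl | rfl
    · constructor
      · intro h1; linarith
      · rintro (h1 | h1)
        · linarith
        · norm_num at h1
    · simp
  · simp
  · rw [abs_of_pos h, sign_pos h]
    rcases hs with rfl | rfl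
    · simp
    · constructor
      · intro h1; linarith
      · rintro (h1 | h1)
        · linarith
        · norm_num at h1

theorem IsAligned.of_sameSignedOrder {p : ℕ} {w x y σ : Fin p → ℝ} {π : Equiv.Perm (Fin p)}
    (hσ : IsSignVector σ) (h : IsAligned w x σ π) (hxy : SameSignedOrder x y) :
    IsAligned w y σ π := by
  refine ⟨fun i => ?_, fun i j hij => ?_⟩
  · have h1 := (sign_mul_eq_abs_iff (hσ i)).1 (h.sign_mul i)
    refine (sign_mul_eq_abs_iff (hσ i)).2 ?_
    rwa [← hxy.sign_eq, ← sign_eq_zero_iff, ← hxy.sign_eq, sign_eq_zero_iff]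
  · exact h.monovary ((hxy.abs_lt_iff _ _).2 hij)

section

variable {p : ℕ} {w : Fin p → ℝ} (hw : StrictAnti w) (hpos : ∀ j, 0 < w j)
include hw hpos

theorem SameSignedOrder.slopeFace_eq {x y : Fin p → ℝ} (h : SameSignedOrder x y) :
    slopeFace w x = slopeFace w y :=
  (slopeFace_subset_of_isAligned hw hpos fun _ _ hσ ha => ha.of_sameSignedOrder hσ h).antisymm
    (slopeFace_subset_of_isAligned hw hpos fun _ _ hσ ha => ha.of_sameSignedOrder hσ h.symm)

/-- If `a's` is constant on the face exposed by `x`, then `a` vanishes where `x` does, as is seen by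
flipping a sign in a generator that belongs to the face. -/
theorem eq_zero_of_const {x a : Fin p → ℝ}
    (ha : ∀ s ∈ slopeFace w x, ∀ t ∈ slopeFace w x, s ⬝ᵥ a = t ⬝ᵥ a) {i : Fin p} (hi : x i = 0) :
    a i = 0 := by
  obtain ⟨σ, π, hσ, hal⟩ := exists_isAligned hw.antitone x
  have hσ' : IsSignVector (Function.update σ i (-σ i)) := fun k => by
    rcases eq_or_ne k i with rfl | hk
    · rw [Function.update_self]
      rcases hσ k with h | h <;> simp [h]
    · rw [Function.update_of_ne hk]; exact hσ k
  have hal' : IsAligned w x (Function.update σ i (-σ i)) π := by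
    refine ⟨fun k => ?_, hal.monovary⟩
    rcases eq_or_ne k i with rfl | hk
    · simp [hi]
    · rw [Function.update_of_ne hk]; exact hal.sign_mul k
  have h := ha _ ((signedPerm_mem_slopeFace_iff hw hpos hσ).2 hal)
    _ ((signedPerm_mem_slopeFace_iff hw hpos hσ').2 hal')
  rw [← sub_eq_zero, ← sub_dotProduct, dotProduct, Finset.sum_eq_single i] at h
  · have hne : σ i ≠ 0 := by rcases hσ i with h | h <;> rw [h] <;> norm_num
    have hw0 := (hpos (π i)).ne'
    simp only [Pi.sub_apply, signedPerm, Function.update_self] at h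
    have h2 : σ i * w (π i) * a i = 0 := by linarith
    simpa [hne, hw0] using h2
  · intro k _ hk
    simp [signedPerm, Function.update_of_ne hk]
  · simp

/-- If `a's` is constant on the face exposed by `x`, then `|x i| = |x j|` forces `|a i| = |a j|`, up
to the signs that the face prescribes, as is seen by exchanging two entries of a generator that
belongs to the face. -/
theorem sign_mul_eq_of_const {x a σ : Fin p → ℝ} {π : Equiv.Perm (Fin p)} (hσ : IsSignVector σ)
    (hal : IsAligned w x σ π)
    (ha : ∀ s ∈ slopeFace w x, ∀ t ∈ slopeFace w x, s ⬝ᵥ a = t ⬝ᵥ a) {i j : Fin p}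
    (hij : |x i| = |x j|) : σ i * a i = σ j * a j := by
  rcases eq_or_ne i j with rfl | hne
  · rfl
  have habs : ∀ k, |x (Equiv.swap i j k)| = |x k| := fun k => by
    rcases eq_or_ne k i with rfl | hki
    · rw [Equiv.swap_apply_left, hij]
    rcases eq_or_ne k j with rfl | hkj
    · rw [Equiv.swap_apply_right, hij]
    rw [Equiv.swap_apply_of_ne_of_ne hki hkj]
  have hal' : IsAligned w x σ (π * Equiv.swap i j) := by
    refine ⟨hal.sign_mul, fun k l (hkl : |x k| < |x l|) => ?_⟩
    rw [← habs k, ← habs l] at hkl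
    exact hal.monovary hkl
  have h := ha _ ((signedPerm_mem_slopeFace_iff hw hpos hσ).2 hal)
    _ ((signedPerm_mem_slopeFace_iff hw hpos hσ).2 hal')
  rw [← sub_eq_zero, ← sub_dotProduct, dotProduct,
    Finset.sum_eq_add_of_mem i j (Finset.mem_univ _) (Finset.mem_univ _) hne] at h
  · simp only [Pi.sub_apply, signedPerm, Equiv.Perm.mul_apply, Equiv.swap_apply_left,
      Equiv.swap_apply_right] at h
    have hw0 : w (π i) - w (π j) ≠ 0 :=
      sub_ne_zero.2 fun he => hne (π.injective (hw.injective he))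
    have h2 : (w (π i) - w (π j)) * (σ i * a i - σ j * a j) = 0 := by linarith
    exact sub_eq_zero.1 ((mul_eq_zero.1 h2).resolve_left hw0)
  · rintro k - ⟨hki, hkj⟩
    simp [signedPerm, Equiv.swap_apply_of_ne_of_ne hki hkj]

theorem slopeFace_const {x : Fin p → ℝ} :
    ∀ s ∈ slopeFace w x, ∀ t ∈ slopeFace w x, s ⬝ᵥ x = t ⬝ᵥ x := fun _ hs _ ht =>
  ((mem_slopeFace_iff hw hpos).1 hs).2.trans ((mem_slopeFace_iff hw hpos).1 ht).2.symm

theorem abs_lt_of_slopeFace_eq {x y : Fin p → ℝ} (h : slopeFace w x = slopeFace w y) {i j : Fin p}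
    (hij : |x i| < |x j|) : |y i| < |y j| := by
  obtain ⟨σ, π, hσ, hx⟩ := exists_isAligned hw.antitone x
  have hy : IsAligned w y σ π := by
    rwa [← signedPerm_mem_slopeFace_iff hw hpos hσ, ← h,
      signedPerm_mem_slopeFace_iff hw hpos hσ]
  have hlt : (w ∘ π) i < (w ∘ π) j := by
    refine lt_of_le_of_ne (hx.monovary hij) fun he => ?_
    rw [π.injective (hw.injective he)] at hij
    exact hij.false
  refine lt_of_le_of_ne (not_lt.1 fun hc => (hy.monovary hc).not_gt hlt) fun he => hij.ne ?_
  have := sign_mul_eq_of_const hw hpos hσ hy (h ▸ slopeFace_const hw hpos (x := x)) he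
  rwa [hx.sign_mul, hx.sign_mul] at this

theorem slopeFace_eq_iff {x y : Fin p → ℝ} :
    slopeFace w x = slopeFace w y ↔ SameSignedOrder x y := by
  refine ⟨fun h => ⟨fun i => ?_, fun i j => ⟨abs_lt_of_slopeFace_eq hw hpos h,
    abs_lt_of_slopeFace_eq hw hpos h.symm⟩⟩, fun h => h.slopeFace_eq hw hpos⟩
  obtain ⟨σ, π, hσ, hx⟩ := exists_isAligned hw.antitone x
  have hy : IsAligned w y σ π := by
    rwa [← signedPerm_mem_slopeFace_iff hw hpos hσ, ← h,
      signedPerm_mem_slopeFace_iff hw hpos hσ]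
  rcases (sign_mul_eq_abs_iff (hσ i)).1 (hx.sign_mul i) with h1 | h1
  · have h0 := slopeFace_const hw hpos (x := y)
    rw [← h] at h0
    rw [h1, eq_zero_of_const hw hpos h0 h1]
  rcases (sign_mul_eq_abs_iff (hσ i)).1 (hy.sign_mul i) with h2 | h2
  · have h0 := slopeFace_const hw hpos (x := x)
    rw [h] at h0
    rw [h2, eq_zero_of_const hw hpos h0 h2]
  · have h3 := h1.trans h2.symm
    generalize SignType.sign (x i) = a at h3 ⊢
    generalize SignType.sign (y i) = b at h3 ⊢
    cases a <;> cases b <;> first | rfl | (norm_num at h3)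

theorem slopeFace_mem_nonemptyFaces (x : Fin p → ℝ) :
    slopeFace w x ∈ nonemptyFaces (signPermutahedron w) := by
  obtain ⟨σ, π, hσ, hx⟩ := exists_isAligned hw.antitone x
  refine ⟨⟨_, (signedPerm_mem_slopeFace_iff hw hpos hσ).2 hx⟩, x, slopeNorm w x,
    fun s hs => ?_, Set.ext fun s => ?_⟩
  · rw [dotProduct_comm]; exact dotProduct_le_slopeNorm hw hpos hs x
  · rw [mem_slopeFace_iff hw hpos, Set.mem_sep_iff, dotProduct_comm]

theorem exists_slopeFace_eq {F : Set (Fin p → ℝ)} (hF : F ∈ nonemptyFaces (signPermutahedron w)) :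
    ∃ x, slopeFace w x = F := by
  obtain ⟨⟨s, hs⟩, a, b, hle, rfl⟩ := hF
  -- a valid inequality `a's ≤ b` that is tight somewhere has `b = ‖a‖_w`
  have hb : b = slopeNorm w a := by
    obtain ⟨σ, π, hσ, ha⟩ := exists_isAligned hw.antitone a
    have h1 := (signedPerm_dotProduct_eq_iff hw hpos hσ π _).2 ha
    have h2 := hle _ (signedPerm_mem w hσ π)
    have h3 := dotProduct_le_slopeNorm hw hpos hs.1 a
    have h4 := hs.2
    rw [dotProduct_comm] at h2 h4
    linarith
  refine ⟨a, Set.ext fun s => ?_⟩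
  rw [mem_slopeFace_iff hw hpos, Set.mem_sep_iff, dotProduct_comm, hb]

end

/-! ### The codimension of a face -/

/-- The dimension formula: the functionals that are constant on `F` form the annihilator of the
direction of the affine hull of `F`. -/
theorem codim_eq_of_const_iff {p r : ℕ} {F : Set (Fin p → ℝ)}
    {T : (Fin r → ℝ) →ₗ[ℝ] (Fin p → ℝ)} (hT : Function.Injective T)
    (h : ∀ a, (∀ s ∈ F, ∀ t ∈ F, s ⬝ᵥ a = t ⬝ᵥ a) ↔ a ∈ LinearMap.range T) : codim F = r := by
  set D := (affineSpan ℝ F).direction with hD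
  have hann : D.dualAnnihilator =
      (LinearMap.range T).map (dotProductEquiv ℝ (Fin p)).toLinearMap := by
    ext φ
    obtain ⟨a, rfl⟩ := (dotProductEquiv ℝ (Fin p)).surjective φ
    have happ : ∀ s, dotProductEquiv ℝ (Fin p) a s = s ⬝ᵥ a := fun s => dotProduct_comm a s
    have hmap : dotProductEquiv ℝ (Fin p) a ∈
        (LinearMap.range T).map (dotProductEquiv ℝ (Fin p)).toLinearMap ↔
          a ∈ LinearMap.range T := by
      rw [Submodule.mem_map_equiv, LinearEquiv.symm_apply_apply]
    rw [hmap, ← h, Submodule.mem_dualAnnihilator, hD, direction_affineSpan, vectorSpan_def]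
    constructor
    · intro h1 s hs t ht
      have h2 := h1 (s - t) (Submodule.subset_span (Set.vsub_mem_vsub hs ht))
      rwa [happ, sub_dotProduct, sub_eq_zero] at h2
    · intro h1
      change Submodule.span ℝ (F -ᵥ F) ≤ LinearMap.ker (dotProductEquiv ℝ (Fin p) a)
      rw [Submodule.span_le]
      rintro _ ⟨s, hs, t, ht, rfl⟩
      rw [SetLike.mem_coe, LinearMap.mem_ker, happ]
      change (s - t) ⬝ᵥ a = 0
      rw [sub_dotProduct, h1 s hs t ht, sub_self]
  have hfin := Subspace.finrank_add_finrank_dualAnnihilator_eq D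
  rw [hann, LinearEquiv.finrank_map_eq, LinearMap.finrank_range_of_inj hT,
    Module.finrank_fin_fun, Module.finrank_fin_fun] at hfin
  rw [codim, ← hD]
  omega

/-- The linear map sending `c` to the vector with entries `sign (m i) * c (|m i|)`, the levels being
counted from `1`; its columns are the layers of the SLOPE model `m`. -/
noncomputable def layerMap {p : ℕ} (m : Fin p → ℤ) (r : ℕ) : (Fin r → ℝ) →ₗ[ℝ] (Fin p → ℝ) :=
  (Matrix.of fun (i : Fin p) (l : Fin r) =>
    if (m i).natAbs = l + 1 then (SignType.sign (m i) : ℝ) else 0).mulVecLin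

section

variable {p r : ℕ} {m : Fin p → ℤ}

theorem layerMap_apply_eq_zero (c : Fin r → ℝ) {i : Fin p} (hi : m i = 0) :
    layerMap m r c i = 0 := by
  simp [layerMap, Matrix.mulVec, dotProduct, hi]

theorem layerMap_apply (c : Fin r → ℝ) {i : Fin p} {l : Fin r} (hi : (m i).natAbs = l + 1) :
    layerMap m r c i = (SignType.sign (m i) : ℝ) * c l := by
  simp only [layerMap, Matrix.mulVecLin_apply, Matrix.mulVec, dotProduct, Matrix.of_apply]
  rw [Finset.sum_eq_single l]
  · rw [if_pos hi]
  · intro k _ hk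
    rw [if_neg, zero_mul]
    intro h
    exact hk (Fin.ext (by omega))
  · simp

theorem exists_level (hr : ∀ i, (m i).natAbs ≤ r) {i : Fin p} (hi : m i ≠ 0) :
    ∃ l : Fin r, (m i).natAbs = l + 1 :=
  ⟨⟨(m i).natAbs - 1, by have := hr i; omega⟩, by simp only; omega⟩

theorem ne_zero_of_level {i : Fin p} {l : Fin r} (hi : (m i).natAbs = l + 1) : m i ≠ 0 := by
  rintro h
  simp [h] at hi

theorem layerMap_injective (hsurj : ∀ l : Fin r, ∃ i, (m i).natAbs = l + 1) :
    Function.Injective (layerMap m r) := by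
  intro c d h
  funext l
  obtain ⟨i, hi⟩ := hsurj l
  have h1 := congrFun h i
  rw [layerMap_apply c hi, layerMap_apply d hi] at h1
  refine mul_left_cancel₀ ?_ h1
  rcases (ne_zero_of_level hi).lt_or_gt with h2 | h2
  · simp [sign_neg h2]
  · simp [sign_pos h2]

theorem layerMap_level (hr : ∀ i, (m i).natAbs ≤ r) :
    layerMap m r (fun l => (l : ℝ) + 1) = fun i => (m i : ℝ) := by
  funext i
  by_cases hi : m i = 0
  · rw [layerMap_apply_eq_zero _ hi, hi, Int.cast_zero]
  · obtain ⟨l, hl⟩ := exists_level hr hi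
    rw [layerMap_apply _ hl]
    have h1 : (((m i).natAbs : ℤ) : ℝ) = (l : ℝ) + 1 := by rw [hl]; push_cast; ring
    rw [← h1, Int.natCast_natAbs, ← sign_intCast_real, Int.cast_abs, sign_mul_abs]

theorem abs_layerMap {c : Fin r → ℝ} (hc : ∀ l, 0 < c l) {i : Fin p} {l : Fin r}
    (hi : (m i).natAbs = l + 1) : |layerMap m r c i| = c l := by
  rw [layerMap_apply c hi, abs_mul, abs_of_pos (hc l)]
  rcases (ne_zero_of_level hi).lt_or_gt with h2 | h2
  · simp [sign_neg h2]
  · simp [sign_pos h2]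

/-- Positive and strictly increasing values on the levels of `m` give a vector with the signs and
the order of `m`. -/
theorem layerMap_sameSignedOrder (hr : ∀ i, (m i).natAbs ≤ r) {c : Fin r → ℝ}
    (hc : ∀ l, 0 < c l) (hmono : StrictMono c) :
    SameSignedOrder (layerMap m r c) (fun i => (m i : ℝ)) := by
  have hcast : ∀ i j, |(m i : ℝ)| < |(m j : ℝ)| ↔ (m i).natAbs < (m j).natAbs := fun i j => by
    rw [← Int.cast_abs, ← Int.cast_abs, Int.cast_lt, Int.abs_eq_natAbs, Int.abs_eq_natAbs, Int.ofNat_lt]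
  refine ⟨fun i => ?_, fun i j => ?_⟩
  · rw [sign_intCast_real]
    by_cases hi : m i = 0
    · rw [layerMap_apply_eq_zero _ hi, hi, sign_zero, sign_zero]
    · obtain ⟨l, hl⟩ := exists_level hr hi
      rw [layerMap_apply _ hl]
      rcases lt_or_gt_of_ne hi with h2 | h2
      · rw [sign_neg h2, sign_neg (by simpa using hc l)]
      · rw [sign_pos h2, sign_pos (by simpa using hc l)]
  · rw [hcast]
    by_cases hj : m j = 0
    · rw [layerMap_apply_eq_zero _ hj, hj]
      simp
    obtain ⟨k, hk⟩ := exists_level hr hj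
    rw [abs_layerMap hc hk, hk]
    by_cases hi : m i = 0
    · rw [layerMap_apply_eq_zero _ hi, hi]
      simpa using hc k
    · obtain ⟨l, hl⟩ := exists_level hr hi
      rw [abs_layerMap hc hl, hl, hmono.lt_iff_lt]
      omega

/-- The functionals constant on the face of `m` are those given by the span of the layers. A
combination of the layers is constant on the face because adding a large multiple of `m` gives a
vector with the signs and the order of `m`, which therefore exposes the same face. -/
theorem const_iff_mem_range_layerMap {w : Fin p → ℝ} (hw : StrictAnti w) (hpos : ∀ j, 0 < w j)
    (hr : ∀ i, (m i).natAbs ≤ r) (hsurj : ∀ l : Fin r, ∃ i, (m i).natAbs = l + 1)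
    (a : Fin p → ℝ) :
    (∀ s ∈ slopeFace w (fun i => (m i : ℝ)), ∀ t ∈ slopeFace w (fun i => (m i : ℝ)),
      s ⬝ᵥ a = t ⬝ᵥ a) ↔ a ∈ LinearMap.range (layerMap m r) := by
  constructor
  · intro ha
    obtain ⟨σ, π, hσ, hal⟩ := exists_isAligned hw.antitone (fun i => (m i : ℝ))
    choose f hf using hsurj
    refine ⟨fun l => σ (f l) * a (f l), funext fun i => ?_⟩
    by_cases hi : m i = 0
    · rw [layerMap_apply_eq_zero _ hi]
      exact (eq_zero_of_const hw hpos ha (by simpa using hi)).symm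
    · obtain ⟨l, hl⟩ := exists_level hr hi
      have habs : |(m (f l) : ℝ)| = |(m i : ℝ)| := by
        rw [← Int.cast_abs, ← Int.cast_abs, Int.abs_eq_natAbs, Int.abs_eq_natAbs, hf, hl]
      have hsgn : (SignType.sign (m i) : ℝ) = σ i := by
        rw [← sign_intCast_real]
        exact ((sign_mul_eq_abs_iff (hσ i)).1 (hal.sign_mul i)).resolve_left (by simpa using hi)
      rw [layerMap_apply _ hl, sign_mul_eq_of_const hw hpos hσ hal ha habs, hsgn, ← mul_assoc]
      rcases hσ i with h | h <;> rw [h] <;> norm_num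
  · rintro ⟨b, rfl⟩
    -- consecutive entries of `b` differ by at most `2‖b‖`, so this `K` makes
    -- `l ↦ K (l + 1) + b l` positive and strictly increasing
    set K : ℝ := 1 + 2 * ‖b‖ with hK
    have hb : ∀ l, |b l| ≤ ‖b‖ := fun l => norm_le_pi_norm b l
    have hb0 : 0 ≤ ‖b‖ := norm_nonneg b
    set c : Fin r → ℝ := K • (fun l : Fin r => (l : ℝ) + 1) + b with hc
    have hcl : ∀ l, c l = K * ((l : ℝ) + 1) + b l := fun l => rfl
    have hcpos : ∀ l, 0 < c l := fun l => by
      have h1 := (abs_le.1 (hb l)).1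
      have h2 : (0 : ℝ) ≤ (l : ℕ) := Nat.cast_nonneg _
      rw [hcl]
      nlinarith
    have hcmono : StrictMono c := fun k l hkl => by
      have h1 := (abs_le.1 (hb l)).1
      have h2 := (abs_le.1 (hb k)).2
      have h3 : ((k : ℕ) : ℝ) + 1 ≤ (l : ℕ) := by exact_mod_cast hkl
      rw [hcl, hcl]
      nlinarith
    have hface := (layerMap_sameSignedOrder hr hcpos hcmono).slopeFace_eq hw hpos
    have hTc : layerMap m r c = K • (fun i => (m i : ℝ)) + layerMap m r b := by
      rw [hc, map_add, map_smul, layerMap_level hr]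
    intro s hs t ht
    have h1 := slopeFace_const hw hpos s hs t ht
    rw [← hface] at hs ht
    have h2 := slopeFace_const hw hpos s hs t ht
    rw [hTc, dotProduct_add, dotProduct_add, dotProduct_smul, dotProduct_smul, h1] at h2
    exact add_left_cancel h2

theorem exists_norm_eq_natCast (m : Fin p → ℤ) : ∃ r : ℕ, ‖m‖ = r ∧ ∀ i, (m i).natAbs ≤ r := by
  set r := Finset.univ.sup fun i => (m i).natAbs with hr
  have hle : ∀ i, (m i).natAbs ≤ r := fun i =>
    Finset.le_sup (f := fun i => (m i).natAbs) (Finset.mem_univ i)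
  have hnorm : ∀ i, ‖m i‖ = ((m i).natAbs : ℝ) := fun i => by
    rw [Int.norm_eq_abs, Nat.cast_natAbs, Int.cast_abs]
  refine ⟨r, le_antisymm ?_ ?_, hle⟩
  · rw [pi_norm_le_iff_of_nonneg (Nat.cast_nonneg _)]
    intro i
    rw [hnorm]
    exact_mod_cast hle i
  · rcases (Finset.univ : Finset (Fin p)).eq_empty_or_nonempty with h | h
    · rw [hr, h]
      simp
    · obtain ⟨i, -, hi⟩ := Finset.exists_mem_eq_sup _ h fun i => (m i).natAbs
      rw [hr, hi, ← hnorm]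
      exact norm_le_pi_norm m i

theorem codim_slopeFace {w : Fin p → ℝ} (hw : StrictAnti w) (hpos : ∀ j, 0 < w j)
    (hm : m ∈ slopeModels p) : (codim (slopeFace w (fun i => (m i : ℝ))) : ℝ) = ‖m‖ := by
  obtain ⟨r, hnorm, hr⟩ := exists_norm_eq_natCast m
  have hsurj : ∀ l : Fin r, ∃ i, (m i).natAbs = l + 1 := fun l => by
    rcases hm with rfl | hm
    · have : r = 0 := by simpa using hnorm.symm
      exact absurd l.2 (by omega)
    · obtain ⟨i, hi⟩ := hm (l + 1) (by omega) (by rw [hnorm]; exact_mod_cast l.2)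
      exact ⟨i, by rw [Int.abs_eq_natAbs] at hi; omega⟩
  rw [hnorm, codim_eq_of_const_iff (layerMap_injective hsurj)
    (const_iff_mem_range_layerMap hw hpos hr hsurj), Int.cast_natCast]

end

/-! ### The face correspondence -/

theorem mainTheorem2 (p : ℕ) (w : Fin p → ℝ) (hw_anti : StrictAnti w) (hw_pos : ∀ j, 0 < w j) :
    Set.BijOn (fun m : Fin p → ℤ => slopeFace w (fun i => (m i : ℝ)))
        (slopeModels p) (nonemptyFaces (signPermutahedron w)) ∧
      (∀ m ∈ slopeModels p, (codim (slopeFace w (fun i => (m i : ℝ))) : ℝ) = ‖m‖) ∧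
      (∀ x : Fin p → ℝ, slopeFace w x = slopeFace w (fun i => (mdl x i : ℝ))) := by
  have hmdl : ∀ x : Fin p → ℝ, slopeFace w x = slopeFace w (fun i => (mdl x i : ℝ)) := fun x =>
    (isModelOf_iff.1 (isModelOf_mdl x)).2.slopeFace_eq hw_anti hw_pos
  refine ⟨⟨fun m _ => slopeFace_mem_nonemptyFaces hw_anti hw_pos _, fun m hm m' hm' h => ?_,
    fun F hF => ?_⟩, fun m hm => codim_slopeFace hw_anti hw_pos hm, hmdl⟩
  · -- both `m` and `m'` are the SLOPE model of `m`
    exact (existsUnique_isModelOf (fun i => (m i : ℝ))).unique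
      (isModelOf_iff.2 ⟨hm, fun _ => rfl, fun _ _ => Iff.rfl⟩)
      (isModelOf_iff.2 ⟨hm', (slopeFace_eq_iff hw_anti hw_pos).1 h⟩)
  · obtain ⟨x, rfl⟩ := exists_slopeFace_eq hw_anti hw_pos hF
    exact ⟨mdl x, (isModelOf_mdl x).mem_slopeModels, (hmdl x).symm⟩
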